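/- Let $\mathbf{C}$ be the category of pseudometric spaces with distances at most $1$ and non-expansive maps (equivalently, symmetric categories enriched in the quantale $[0,1]_\oplus$, i.e. $[0,1]$ with the reversed order and truncated addition). Equip $[0,1]$ with the metric $|u-v|$. For $X\in\mathbf{C}$, a Borel probability measure $\mu$ on $X$ is called tight if for every $\varepsilon>0$ there is a totally bounded $Y\subseteq X$ with $\mu(X\setminus Y)<\varepsilon$ (outer measure). Let $\mathcal{K}X$ be the set of tight Borel probability measures on $X$ with the distance $d(\mu,\nu)=\sup_f\left(\int f\,d\mu-\int f\,d\nu\right)$, where $f$ ranges over the non-expansive maps $X\to[0,1]$; on morphisms, $\mathcal{K}$ acts by push-forward. Let $1+X$ be the coproduct in $\mathbf{C}$ (the additional point has distance $1$ from every point of $X$), and for a finite set $A$ let $(-)^A$ be the $A$-fold power with the supremum distance. Put $\mathsf{F}=\mathcal{K}(1+-)^A\colon\mathbf{C}\to\mathbf{C}$. For $a\in A$, let $\mathbb{E}^{a,+1}$ be the predicate lifting for $\mathsf{F}$ that sends a non-expansive map $f\colon X\to[0,1]$ to the non-expansive map $\mathsf{F}X\to[0,1]$, $l\mapsto\int_{1+X}f^{+1}\,dl_a$,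 where $f^{+1}$ extends $f$ by the value $1$ at the additional point. Let $\Lambda=\{\mathbb{E}^{a,+1}\mid a\in A\}$, and let $\mathcal{L}(\Lambda)$ be the set of formulas $$\phi::=\top\mid\phi_1\vee\phi_2\mid\phi_1\wedge\phi_2\mid u\otimes\phi\mid\hom_s(u,\phi)\mid\lambda(\phi)\qquad(u\in[0,1],\ \lambda\in\Lambda).$$ Over an $\mathsf{F}$-coalgebra $\alpha\colon X\to\mathsf{F}X$, each formula is interpreted as a non-expansive map $[\![\phi]\!]_\alpha\colon X\to[0,1]$: in terms of the usual order of numbers, $\top$ is the constant $0$, $\vee$ is the minimum, $\wedge$ is the maximum, $u\otimes v=\min(u+v,1)$, $\hom_s(u,v)=|u-v|$, and $[\![\lambda(\phi)]\!]_\alpha=\lambda([\![\phi]\!]_\alpha)\circ\alpha$. The logical distance and the behavioural distance of states $x,y$ of $(X,\alpha)$ are $$ld_\alpha(x,y)=\sup_{\phi\in\mathcal{L}(\Lambda)}\bigl|[\![\phi]\!]_\alpha(x)-[\![\phi]\!]_\alpha(y)\bigr|,\qquad bd_\alpha(x,y)=\inf_{f}\,d_Y(f(x),f(y)),$$ where $f$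 ranges over all $\mathsf{F}$-coalgebra morphisms from $(X,\alpha)$ to $\mathsf{F}$-coalgebras $(Y,\beta)$. Then, for every finite set $A$, the logic $\mathcal{L}(\Lambda)$ is expressive for $\mathsf{F}$: for every $\mathsf{F}$-coalgebra $(X,\alpha)$ and all $x,y\in X$, $bd_\alpha(x,y)\le ld_\alpha(x,y)$. -/

import Mathlib

open CategoryTheory MeasureTheory

universe u

noncomputable section

/-! ### The category of symmetric categories enriched in the quantale `[0,1]` with truncated addition

The quantale `[0,1]_⊕` carries the order opposite to the numerical one.  Everything below is written
with the numerical order, so quantalic joins are numerical infima, quantalic meets are numerical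
suprema, the quantalic top is the number `0`, symmetric enriched categories are the pseudometric
spaces with distances at most `1`, and enriched functors are the non-expansive maps. -/

/-- Pseudometric spaces bounded by `1`. -/
structure BPMet : Type (u + 1) where
  carrier : Type u
  [str : PseudoMetricSpace carrier]
  dist_le_one' : ∀ x y : carrier, dist x y ≤ 1

attribute [instance] BPMet.str

instance : CoeSort BPMet.{u} (Type u) := ⟨BPMet.carrier⟩

theorem BPMet.dist_le_one (X : BPMet.{u}) (x y : X) : dist x y ≤ 1 := X.dist_le_one' x y

/-- Non-expansive maps. -/
@[ext]
structure NonexpMap (X Y : Type*) [PseudoMetricSpace X] [PseudoMetricSpace Y] where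
  toFun : X → Y
  dist_le' : ∀ x y, dist (toFun x) (toFun y) ≤ dist x y

namespace NonexpMap

variable {X Y Z : Type*} [PseudoMetricSpace X] [PseudoMetricSpace Y] [PseudoMetricSpace Z]

instance : FunLike (NonexpMap X Y) X Y where
  coe := toFun
  coe_injective := fun _ _ h => NonexpMap.ext h

theorem ext_apply {f g : NonexpMap X Y} (h : ∀ x, f x = g x) : f = g := DFunLike.ext f g h

theorem dist_le (f : NonexpMap X Y) (x y : X) : dist (f x) (f y) ≤ dist x y := f.dist_le' x y

@[simp]
theorem mk_apply (f : X → Y) (h : ∀ x y, dist (f x) (f y) ≤ dist x y) (x : X) :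
    (NonexpMap.mk f h) x = f x := rfl

theorem continuous (f : NonexpMap X Y) : Continuous f :=
  (LipschitzWith.of_dist_le_mul (K := 1) (by simpa using f.dist_le)).continuous

theorem uniformContinuous (f : NonexpMap X Y) : UniformContinuous f :=
  (LipschitzWith.of_dist_le_mul (K := 1) (by simpa using f.dist_le)).uniformContinuous

def id (X : Type*) [PseudoMetricSpace X] : NonexpMap X X := ⟨fun x => x, fun _ _ => le_rfl⟩

def comp (g : NonexpMap Y Z) (f : NonexpMap X Y) : NonexpMap X Z :=
  ⟨fun x => g (f x), fun x y => (g.dist_le _ _).trans (f.dist_le x y)⟩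

@[simp]
theorem id_apply (x : X) : NonexpMap.id X x = x := rfl

@[simp]
theorem comp_apply (g : NonexpMap Y Z) (f : NonexpMap X Y) (x : X) : g.comp f x = g (f x) := rfl

end NonexpMap

instance : Category BPMet.{u} where
  Hom X Y := NonexpMap X Y
  id X := NonexpMap.id X
  comp f g := NonexpMap.comp g f

instance : ConcreteCategory BPMet.{u} (fun X Y => NonexpMap X Y) where
  hom f := f
  ofHom f := f
  id_apply _ := rfl
  comp_apply _ _ _ := rfl

/-- Every space carries its Borel `σ`-algebra. -/
instance (X : BPMet.{u}) : MeasurableSpace X := borel X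

instance (X : BPMet.{u}) : BorelSpace X := ⟨rfl⟩

theorem NonexpMap.measurable {X Y : BPMet.{u}} (f : NonexpMap X Y) : Measurable f :=
  f.continuous.measurable

/-! ### Predicates, predicate liftings, formulas -/

/-- `[0,1]`-valued predicates on a space: the non-expansive maps to `[0,1]` with the metric
`|u - v|`. -/
abbrev Pred (X : Type*) [PseudoMetricSpace X] := NonexpMap X unitInterval

/-- The tensor of the quantale: truncated addition. -/
def tensor (v w : unitInterval) : unitInterval :=
  ⟨min ((v : ℝ) + w) 1, le_min (add_nonneg v.2.1 w.2.1) zero_le_one, min_le_right _ _⟩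

/-- The internal hom of the quantale: truncated subtraction `w - v`. -/
def qhom (v w : unitInterval) : unitInterval :=
  ⟨max ((w : ℝ) - v) 0, le_max_right _ _,
    max_le (by linarith [w.2.2, v.2.1]) zero_le_one⟩

/-- The symmetrized internal hom. The quantalic meet is the numerical maximum. -/
def qhomSymm (v w : unitInterval) : unitInterval := qhom v w ⊔ qhom w v

theorem tensor_adjunction (v w z : unitInterval) : w ≤ tensor v z ↔ qhom v w ≤ z := by
  simp only [tensor, qhom, ← Subtype.coe_le_coe, le_min_iff, max_le_iff]
  have h1 := w.2.2
  have h2 := z.2.1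
  constructor
  · rintro ⟨h, -⟩
    exact ⟨by linarith, h2⟩
  · rintro ⟨h, -⟩
    exact ⟨by linarith, h1⟩

theorem coe_qhomSymm (v w : unitInterval) : (qhomSymm v w : ℝ) = |(v : ℝ) - w| := by
  have h : (qhomSymm v w : ℝ) = max (max ((w : ℝ) - v) 0) (max ((v : ℝ) - w) 0) := by
    unfold qhomSymm
    rcases le_total (qhom v w) (qhom w v) with h | h
    · rw [sup_eq_right.2 h]
      exact (max_eq_right (Subtype.coe_le_coe.2 h)).symm
    · rw [sup_eq_left.2 h]
      exact (max_eq_left (Subtype.coe_le_coe.2 h)).symm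
  rw [h]
  rcases le_total (v : ℝ) w with h | h
  · rw [abs_of_nonpos (by linarith), max_eq_left (by linarith : (0 : ℝ) ≤ w - v),
      max_eq_right (by linarith : (v : ℝ) - w ≤ 0), max_eq_left (by linarith)]
    ring
  · rw [abs_of_nonneg (by linarith), max_eq_right (by linarith : (w : ℝ) - v ≤ 0),
      max_eq_left (by linarith : (0 : ℝ) ≤ v - w), max_eq_right (by linarith)]

/-- The metric of `[0,1]` is the symmetrized internal hom of the quantale. -/
theorem dist_eq_qhomSymm (v w : unitInterval) : dist v w = qhomSymm v w := by
  rw [coe_qhomSymm, Subtype.dist_eq, Real.dist_eq]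

theorem unitInterval_dist_le_one (v w : unitInterval) : dist v w ≤ 1 := by
  rw [dist_eq_qhomSymm]
  exact (qhomSymm v w).2.2

namespace Pred

variable {X : Type*} [PseudoMetricSpace X]

/-- The constant predicate with value `0`, the quantalic top. -/
def top (X : Type*) [PseudoMetricSpace X] : Pred X :=
  ⟨fun _ => 0, fun _ _ => by simp⟩

/-- Quantalic binary join, the numerical minimum. -/
def or (f g : Pred X) : Pred X :=
  ⟨fun x => f x ⊓ g x, fun x y => by
    have hf := f.dist_le x y
    have hg := g.dist_le x y
    rw [Subtype.dist_eq, Real.dist_eq] at *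
    exact (abs_min_sub_min_le_max (f x : ℝ) (g x) (f y) (g y)).trans (max_le hf hg)⟩

/-- Quantalic binary meet, the numerical maximum. -/
def and (f g : Pred X) : Pred X :=
  ⟨fun x => f x ⊔ g x, fun x y => by
    have hf := f.dist_le x y
    have hg := g.dist_le x y
    rw [Subtype.dist_eq, Real.dist_eq] at *
    exact (abs_max_sub_max_le_max (f x : ℝ) (g x) (f y) (g y)).trans (max_le hf hg)⟩

/-- `v ⊗ f`. -/
def tensor (v : unitInterval) (f : Pred X) : Pred X :=
  ⟨fun x => _root_.tensor v (f x), fun x y => by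
    have hf := f.dist_le x y
    rw [Subtype.dist_eq, Real.dist_eq] at *
    refine (abs_min_sub_min_le_max ((v : ℝ) + f x) 1 ((v : ℝ) + f y) 1).trans (max_le ?_ ?_)
    · rwa [add_sub_add_left_eq_sub]
    · simp⟩

/-- `hom_s(v, f)`. -/
def homSymm (v : unitInterval) (f : Pred X) : Pred X :=
  ⟨fun x => qhomSymm v (f x), fun x y => by
    have hf := f.dist_le x y
    rw [Subtype.dist_eq, Real.dist_eq] at *
    rw [coe_qhomSymm, coe_qhomSymm]
    refine (abs_abs_sub_abs_le _ _).trans ?_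
    rw [sub_sub_sub_cancel_left, abs_sub_comm]
    exact hf⟩

end Pred

/-- Unary predicate liftings for an endofunctor `F`: natural transformations from
`Hom(-, [0,1])` to `Hom(F -, [0,1])`. -/
@[ext]
structure PredicateLifting (F : BPMet.{u} ⥤ BPMet.{u}) where
  app : ∀ X : BPMet.{u}, Pred X → Pred (F.obj X)
  naturality : ∀ {X Y : BPMet.{u}} (g : X ⟶ Y) (f : Pred Y),
    app X (NonexpMap.comp f g) = NonexpMap.comp (app Y f) (F.map g)

/-- Formulas of the coalgebraic modal logic given by a set `L` of predicate liftings. -/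
inductive Formula {F : BPMet.{u} ⥤ BPMet.{u}} (L : Set (PredicateLifting F)) : Type (u + 1)
  | top : Formula L
  | or : Formula L → Formula L → Formula L
  | and : Formula L → Formula L → Formula L
  | tensor : unitInterval → Formula L → Formula L
  | homSymm : unitInterval → Formula L → Formula L
  | modal : L → Formula L → Formula L

/-- The interpretation of a formula over a coalgebra. -/
def Formula.sem {F : BPMet.{u} ⥤ BPMet.{u}} {L : Set (PredicateLifting F)}
    (α : Endofunctor.Coalgebra F) : Formula L → Pred α.V
  | .top => Pred.top α.V
  | .or φ ψ => Pred.or (φ.sem α) (ψ.sem α)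
  | .and φ ψ => Pred.and (φ.sem α) (ψ.sem α)
  | .tensor v φ => Pred.tensor v (φ.sem α)
  | .homSymm v φ => Pred.homSymm v (φ.sem α)
  | .modal l φ => NonexpMap.comp (l.1.app α.V (φ.sem α)) α.str

/-! ### Behavioural distance, logical distance, expressiveness -/

/-- Behavioural distance: the quantalic join, that is, the numerical infimum, of the distances
`d(f x, f y)` over all coalgebra morphisms `f` out of the coalgebra. -/
def behaviouralDist {F : BPMet.{u} ⥤ BPMet.{u}} (α : Endofunctor.Coalgebra F) (x y : α.V) : ℝ :=
  ⨅ m : (β : Endofunctor.Coalgebra F) × (α ⟶ β), dist (m.2.f x) (m.2.f y)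

/-- Logical distance: the numerical supremum of the differences of formula values. -/
def logicalDist {F : BPMet.{u} ⥤ BPMet.{u}} (L : Set (PredicateLifting F))
    (α : Endofunctor.Coalgebra F) (x y : α.V) : ℝ :=
  ⨆ φ : Formula L, (qhomSymm (φ.sem α x) (φ.sem α y) : ℝ)

/-- The logic of `L` is expressive if logical distance is below behavioural distance in the
quantalic order, that is, if behavioural distance is numerically at most logical distance, on
every coalgebra. -/
def IsExpressive {F : BPMet.{u} ⥤ BPMet.{u}} (L : Set (PredicateLifting F)) : Prop :=
  ∀ (α : Endofunctor.Coalgebra F) (x y : α.V), behaviouralDist α x y ≤ logicalDist L α x y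

/-! ### The Kantorovich functor on tight probability measures -/

/-- A measure is tight if totally bounded sets have complements of arbitrarily small (outer)
measure. -/
def IsTight {X : BPMet.{u}} (μ : Measure X) : Prop :=
  ∀ ε : ENNReal, 0 < ε → ∃ Y : Set X, TotallyBounded Y ∧ μ Yᶜ < ε

/-- Tight Borel probability measures. -/
@[ext]
structure TightProb (X : BPMet.{u}) : Type u where
  toMeasure : Measure X
  isProbabilityMeasure : IsProbabilityMeasure toMeasure
  isTight : IsTight toMeasure

attribute [instance] TightProb.isProbabilityMeasure

namespace TightProb

variable {X Y : BPMet.{u}}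

theorem integrable (μ : TightProb X) (f : Pred X) :
    Integrable (fun x => (f x : ℝ)) μ.toMeasure := by
  refine Integrable.of_bound (C := 1)
    (continuous_subtype_val.comp f.continuous).measurable.aestronglyMeasurable ?_
  refine Filter.Eventually.of_forall fun x => ?_
  rw [Real.norm_eq_abs, abs_of_nonneg (f x).2.1]
  exact (f x).2.2

/-- The expected value of a predicate. -/
def expect (μ : TightProb X) (f : Pred X) : unitInterval :=
  ⟨∫ x, (f x : ℝ) ∂μ.toMeasure, integral_nonneg fun x => (f x).2.1, by
    have h : ∫ x, (f x : ℝ) ∂μ.toMeasure ≤ ∫ _, (1 : ℝ) ∂μ.toMeasure :=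
      integral_mono (μ.integrable f) (integrable_const _) fun x => (f x).2.2
    simpa using h⟩

/-- The Kantorovich distance. -/
def kantDist (μ ν : TightProb X) : ℝ :=
  ⨆ f : Pred X, (∫ x, (f x : ℝ) ∂μ.toMeasure - ∫ x, (f x : ℝ) ∂ν.toMeasure)

theorem diff_le_one (μ ν : TightProb X) (f : Pred X) :
    ∫ x, (f x : ℝ) ∂μ.toMeasure - ∫ x, (f x : ℝ) ∂ν.toMeasure ≤ 1 := by
  have h1 := (μ.expect f).2.2
  have h2 := (ν.expect f).2.1
  simp only [expect] at h1 h2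
  linarith

theorem diff_le_kantDist (μ ν : TightProb X) (f : Pred X) :
    ∫ x, (f x : ℝ) ∂μ.toMeasure - ∫ x, (f x : ℝ) ∂ν.toMeasure ≤ kantDist μ ν :=
  le_ciSup (f := fun f : Pred X =>
    ∫ x, (f x : ℝ) ∂μ.toMeasure - ∫ x, (f x : ℝ) ∂ν.toMeasure)
    ⟨1, by rintro _ ⟨g, rfl⟩; exact diff_le_one μ ν g⟩ f

instance : Nonempty (Pred X) := ⟨Pred.top X⟩

/-- The pointwise numerical complement `1 - f` of a predicate. -/
def compl (f : Pred X) : Pred X := Pred.homSymm 1 f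

theorem coe_compl (f : Pred X) (x : X) : (compl f x : ℝ) = 1 - f x := by
  have h : (compl f x : ℝ) = |((1 : unitInterval) : ℝ) - f x| := coe_qhomSymm 1 (f x)
  rw [h, abs_of_nonneg (by simpa using (f x).2.2)]
  simp

theorem integral_compl (μ : TightProb X) (f : Pred X) :
    ∫ x, (compl f x : ℝ) ∂μ.toMeasure = 1 - ∫ x, (f x : ℝ) ∂μ.toMeasure := by
  simp_rw [coe_compl]
  rw [integral_sub (integrable_const _) (μ.integrable f)]
  simp

theorem kantDist_comm_le (μ ν : TightProb X) : kantDist μ ν ≤ kantDist ν μ := by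
  refine ciSup_le fun f => ?_
  have h := diff_le_kantDist ν μ (compl f)
  rw [integral_compl, integral_compl] at h
  linarith

instance : PseudoMetricSpace (TightProb X) where
  dist := kantDist
  dist_self μ := by simp [kantDist]
  dist_comm μ ν := le_antisymm (kantDist_comm_le μ ν) (kantDist_comm_le ν μ)
  dist_triangle μ ν ρ := by
    refine ciSup_le fun f => ?_
    have h1 := diff_le_kantDist μ ν f
    have h2 := diff_le_kantDist ν ρ f
    linarith

theorem dist_def (μ ν : TightProb X) : dist μ ν = kantDist μ ν := rfl

/-- Push-forward of tight probability measures along a non-expansive map. -/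
def map (g : NonexpMap X Y) (μ : TightProb X) : TightProb Y where
  toMeasure := μ.toMeasure.map g
  isProbabilityMeasure := Measure.isProbabilityMeasure_map g.measurable.aemeasurable
  isTight := by
    intro ε hε
    obtain ⟨S, hS, hμ⟩ := μ.isTight ε hε
    refine ⟨closure (g '' S), (hS.image g.uniformContinuous).closure, ?_⟩
    rw [Measure.map_apply g.measurable isClosed_closure.measurableSet.compl]
    refine (measure_mono ?_).trans_lt hμ
    intro x hx hxS
    exact hx (subset_closure ⟨x, hxS, rfl⟩)

theorem integral_map (g : NonexpMap X Y) (μ : TightProb X) (f : Pred Y) :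
    ∫ y, (f y : ℝ) ∂(map g μ).toMeasure = ∫ x, (f (g x) : ℝ) ∂μ.toMeasure :=
  MeasureTheory.integral_map g.measurable.aemeasurable
    (continuous_subtype_val.comp f.continuous).measurable.aestronglyMeasurable

end TightProb

/-- The Kantorovich functor: tight Borel probability measures with the Kantorovich distance. -/
def kantFunctor : BPMet.{u} ⥤ BPMet.{u} where
  obj X := ⟨TightProb X, fun μ ν => ciSup_le (TightProb.diff_le_one μ ν)⟩
  map {X Y} g := (⟨TightProb.map g, fun μ ν => by
    refine ciSup_le fun f => ?_
    rw [TightProb.integral_map, TightProb.integral_map]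
    exact TightProb.diff_le_kantDist μ ν (NonexpMap.comp f g)⟩ :
      NonexpMap (TightProb X) (TightProb Y))
  map_id X := NonexpMap.ext_apply fun μ => TightProb.ext (Measure.map_id (μ := μ.toMeasure))
  map_comp {X Y Z} g h := NonexpMap.ext_apply fun μ => TightProb.ext
    (Measure.map_map (NonexpMap.measurable h) (NonexpMap.measurable g)).symm

/-- The expectation predicate lifting of the Kantorovich functor. -/
def expectation : PredicateLifting kantFunctor.{u} where
  app X f := (⟨fun μ => μ.expect f, fun μ ν => by
    rw [Subtype.dist_eq, Real.dist_eq, abs_le]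
    have h1 := TightProb.diff_le_kantDist μ ν f
    have h2 := TightProb.diff_le_kantDist ν μ f
    rw [← TightProb.dist_def] at h1 h2
    rw [dist_comm] at h2
    simp only [TightProb.expect]
    constructor <;> linarith⟩ : Pred (TightProb X))
  naturality g f := NonexpMap.ext_apply fun μ =>
    Subtype.ext (TightProb.integral_map g μ f).symm

/-! ### The functor `1 + -` and finite powers -/

/-- The disjoint union of a type with a one-point type. -/
inductive OnePlus (X : Type u) : Type u
  | star : OnePlus X
  | inc : X → OnePlus X

namespace OnePlus

/-- The coproduct distance: distinct summands have distance `1`, the bottom of the quantale. -/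
def distFn {X : Type u} [PseudoMetricSpace X] : OnePlus X → OnePlus X → ℝ
  | star, star => 0
  | inc x, inc y => dist x y
  | _, _ => 1

def map {X Y : Type u} (g : X → Y) : OnePlus X → OnePlus Y
  | star => star
  | inc x => inc (g x)

theorem distFn_triangle (X : BPMet.{u}) (p q r : OnePlus X) :
    distFn p r ≤ distFn p q + distFn q r := by
  rcases p with _ | x <;> rcases q with _ | y <;> rcases r with _ | z <;>
    simp only [distFn] <;>
    first
      | exact dist_triangle x y z
      | linarith [X.dist_le_one x z]
      | linarith [dist_nonneg (x := x) (y := y)]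
      | linarith [dist_nonneg (x := y) (y := z)]
      | norm_num

instance (X : BPMet.{u}) : PseudoMetricSpace (OnePlus X) where
  dist := distFn
  dist_self p := by rcases p with _ | x <;> simp [distFn]
  dist_comm p q := by rcases p with _ | x <;> rcases q with _ | y <;> simp [distFn, dist_comm]
  dist_triangle := distFn_triangle X

end OnePlus

/-- The functor `1 + -`, where the coproduct is taken in `BPMet`. -/
def onePlusFunctor : BPMet.{u} ⥤ BPMet.{u} where
  obj X := ⟨OnePlus X, fun p q => by
    rcases p with _ | x <;> rcases q with _ | y
    · exact zero_le_one
    · exact le_refl (1 : ℝ)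
    · exact le_refl (1 : ℝ)
    · exact X.dist_le_one x y⟩
  map {X Y} g := (⟨OnePlus.map g, fun p q => by
    rcases p with _ | x <;> rcases q with _ | y
    · exact le_refl (0 : ℝ)
    · exact le_refl (1 : ℝ)
    · exact le_refl (1 : ℝ)
    · exact NonexpMap.dist_le (show NonexpMap X Y from g) x y⟩ :
      NonexpMap (OnePlus X) (OnePlus Y))
  map_id X := NonexpMap.ext_apply fun p => by rcases p with _ | x <;> rfl
  map_comp g h := NonexpMap.ext_apply fun p => by rcases p with _ | x <;> rfl

/-- The extension of `f` to `1 + X` that sends the additional point to the number `1`. -/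
def plusOne {X : BPMet.{u}} (f : Pred X) : Pred (onePlusFunctor.obj X) :=
  (⟨fun p => match p with
      | .star => 1
      | .inc x => f x,
    fun p q => by
      rcases p with _ | x <;> rcases q with _ | y
      · exact (dist_self (1 : unitInterval)).le
      · exact unitInterval_dist_le_one _ _
      · exact unitInterval_dist_le_one _ _
      · exact f.dist_le x y⟩ : Pred (OnePlus X))

/-- The functor sending `X` to its power `X^A`, with the supremum distance. -/
def powerFunctor (A : Type u) [Fintype A] : BPMet.{u} ⥤ BPMet.{u} where
  obj X := ⟨A → X, fun s t => (dist_pi_le_iff zero_le_one).2 fun a => X.dist_le_one (s a) (t a)⟩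
  map {X Y} g := (⟨fun s a => g (s a), fun s t =>
    (dist_pi_le_iff dist_nonneg).2 fun a =>
      (NonexpMap.dist_le (show NonexpMap X Y from g) (s a) (t a)).trans (dist_le_pi_dist s t a)⟩ :
      NonexpMap (A → X) (A → Y))
  map_id _ := rfl
  map_comp _ _ := rfl

/-- The functor `K(1 + -)^A`, whose coalgebras are the continuous probabilistic transition systems
with actions in `A`. -/
def ptsFunctor (A : Type u) [Fintype A] : BPMet.{u} ⥤ BPMet.{u} :=
  onePlusFunctor ⋙ kantFunctor ⋙ powerFunctor A

/-- The predicate lifting `E^{a,+1}`, sending `f` and a family `l` of tight probability measures on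
`1 + X` to the expected value of `f^{+1}` with respect to `l a`. -/
def expectationAt {A : Type u} [Fintype A] (a : A) : PredicateLifting (ptsFunctor A) where
  app X f := (⟨fun l => (l a).expect (plusOne f), fun l l' =>
    (NonexpMap.dist_le (expectation.app _ (plusOne f)) (l a) (l' a)).trans
      (dist_le_pi_dist l l' a)⟩ : Pred (A → TightProb (onePlusFunctor.obj X)))
  naturality {X Y} g f := NonexpMap.ext_apply fun l => by
    have h : plusOne (NonexpMap.comp f g) =
        NonexpMap.comp (plusOne f) (onePlusFunctor.map g) :=
      NonexpMap.ext_apply fun p => by rcases p with _ | x <;> rfl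
    have h2 := DFunLike.congr_fun (expectation.naturality (onePlusFunctor.map g) (plusOne f)) (l a)
    rw [← h] at h2
    exact h2

/-- The set of modalities of quantitative probabilistic modal logic. -/
def expectationModalities (A : Type u) [Fintype A] : Set (PredicateLifting (ptsFunctor A)) :=
  Set.range expectationAt

end

/-! Give the state space the logical distance. If the transition structure is still non-expansive
for it, the identity becomes a coalgebra morphism out of `α`, and the infimum defining behavioural
distance is at most the distance in this target, which is the logical distance.

Non-expansiveness means that a test predicate `f` on `1 + X`, non-expansive for the logical
distance, has expectations under the transitions of `x` and `y` differing by at most their logical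
distance. For modal formulas this is immediate. By a lattice Stone–Weierstrass argument, formulas
approximate all predicates non-expansive for the logical distance, uniformly on totally bounded sets
(`exists_formula_approx_totallyBounded`). Tightness makes the remainder negligible, which settles
the case `f = g^{+1}` (`abs_integral_plusOne_sub_le_logicalDist`).

The value `c` of `f` at the extra point is arbitrary, but `f = c·g^{+1} + (1-c)·(1-(1-g)^{+1})`
(`integral_onePlus_eq`). This is a convex combination, so no factor is lost. -/

noncomputable section

/-! ### Logical distance and approximation by formulas -/

section Interpolation

variable {F : BPMet.{u} ⥤ BPMet.{u}} {L : Set (PredicateLifting F)}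

namespace Formula

variable (α : Endofunctor.Coalgebra F)

theorem coe_sem_top (x : α.V) : (((top : Formula L).sem α x : unitInterval) : ℝ) = 0 := rfl

theorem coe_sem_or (φ ψ : Formula L) (x : α.V) :
    (((φ.or ψ).sem α x : unitInterval) : ℝ) = min (φ.sem α x : ℝ) (ψ.sem α x) := rfl

theorem coe_sem_and (φ ψ : Formula L) (x : α.V) :
    (((φ.and ψ).sem α x : unitInterval) : ℝ) = max (φ.sem α x : ℝ) (ψ.sem α x) := rfl

theorem coe_sem_tensor (v : unitInterval) (φ : Formula L) (x : α.V) :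
    (((φ.tensor v).sem α x : unitInterval) : ℝ) = min ((v : ℝ) + φ.sem α x) 1 := rfl

theorem coe_sem_homSymm (v : unitInterval) (φ : Formula L) (x : α.V) :
    (((φ.homSymm v).sem α x : unitInterval) : ℝ) = |(v : ℝ) - φ.sem α x| := coe_qhomSymm _ _

/-- The formula whose value is constantly `v`. -/
def const (v : unitInterval) : Formula L := .tensor v .top

theorem coe_sem_const (v : unitInterval) (x : α.V) :
    (((const v : Formula L).sem α x : unitInterval) : ℝ) = v := by
  rw [const, coe_sem_tensor, coe_sem_top, add_zero, min_eq_left v.2.2]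

/-- The truncated difference of a formula and a constant. -/
def tsub (φ : Formula L) (v : unitInterval) : Formula L := .homSymm v (φ.and (const v))

/-- Taking the maximum with `v` first fixes the sign inside the absolute value, so the symmetric hom
acts as a one-sided subtraction. -/
theorem coe_sem_tsub (φ : Formula L) (v : unitInterval) (x : α.V) :
    (((φ.tsub v).sem α x : unitInterval) : ℝ) = max ((φ.sem α x : ℝ) - v) 0 := by
  rw [tsub, coe_sem_homSymm, coe_sem_and, coe_sem_const, abs_sub_comm,
    abs_of_nonneg (sub_nonneg.2 (le_max_right _ _)), ← max_sub_sub_right, sub_self]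

end Formula

variable (L) (α : Endofunctor.Coalgebra F)

/-- A real `⨆` defaults to `0` on unbounded families; this bound makes `logicalDist` a genuine
supremum. -/
theorem bddAbove_range_qhomSymm_sem (x y : α.V) :
    BddAbove (Set.range fun φ : Formula L => (qhomSymm (φ.sem α x) (φ.sem α y) : ℝ)) :=
  ⟨1, by rintro _ ⟨φ, rfl⟩; exact (qhomSymm _ _).2.2⟩

variable {L} in
theorem abs_sem_sub_sem_le_logicalDist (φ : Formula L) (x y : α.V) :
    |(φ.sem α x : ℝ) - φ.sem α y| ≤ logicalDist L α x y := by
  rw [← coe_qhomSymm]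
  exact le_ciSup (bddAbove_range_qhomSymm_sem L α x y) φ

theorem logicalDist_le {x y : α.V} {c : ℝ}
    (h : ∀ φ : Formula L, |(φ.sem α x : ℝ) - φ.sem α y| ≤ c) : logicalDist L α x y ≤ c := by
  have : Nonempty (Formula L) := ⟨.top⟩
  exact ciSup_le fun φ => (coe_qhomSymm _ _).trans_le (h φ)

theorem logicalDist_self (x : α.V) : logicalDist L α x x = 0 := by
  refine le_antisymm (logicalDist_le L α fun φ => by simp) ?_
  exact (abs_nonneg _).trans (abs_sem_sub_sem_le_logicalDist α (.top : Formula L) x x)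

theorem logicalDist_comm (x y : α.V) : logicalDist L α x y = logicalDist L α y x := by
  refine le_antisymm (logicalDist_le L α fun φ => ?_) (logicalDist_le L α fun φ => ?_) <;>
  · rw [abs_sub_comm]
    exact abs_sem_sub_sem_le_logicalDist α φ _ _

theorem logicalDist_triangle (x y z : α.V) :
    logicalDist L α x z ≤ logicalDist L α x y + logicalDist L α y z :=
  logicalDist_le L α fun φ => (abs_sub_le _ (φ.sem α y : ℝ) _).trans
    (add_le_add (abs_sem_sub_sem_le_logicalDist α φ x y)
      (abs_sem_sub_sem_le_logicalDist α φ y z))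

theorem logicalDist_le_dist (x y : α.V) : logicalDist L α x y ≤ dist x y :=
  logicalDist_le L α fun φ => (φ.sem α).dist_le x y

/-- The state space of a coalgebra with the logical distance. -/
def logicalSpace : BPMet.{u} where
  carrier := α.V
  str :=
    { dist := logicalDist L α
      dist_self := logicalDist_self L α
      dist_comm := logicalDist_comm L α
      dist_triangle := logicalDist_triangle L α }
  dist_le_one' x y := (logicalDist_le_dist L α x y).trans (α.V.dist_le_one x y)

/-- The identity, from the original distance to the logical distance. -/
def toLogicalSpace : NonexpMap α.V (logicalSpace L α) :=
  ⟨fun x => x, logicalDist_le_dist L α⟩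

variable {L}

/-- A formula with prescribed values at two points, up to `ε`. -/
theorem exists_formula_approx_pair_of_le {p q : α.V} {s t : unitInterval} (hst : s ≤ t)
    (h : (t : ℝ) - s ≤ logicalDist L α p q) {ε : ℝ} (hε : 0 < ε) :
    ∃ φ : Formula L, |(φ.sem α p : ℝ) - s| ≤ ε ∧ |(φ.sem α q : ℝ) - t| ≤ ε := by
  obtain ⟨ψ, hψ⟩ : ∃ ψ : Formula L, (t : ℝ) - s - ε ≤ (ψ.sem α q : ℝ) - ψ.sem α p := by
    have : Nonempty (Formula L) := ⟨.top⟩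
    obtain ⟨ψ, hψ⟩ := exists_lt_of_lt_ciSup (lt_of_lt_of_le (sub_lt_self _ hε) h)
    rw [coe_qhomSymm] at hψ
    rcases abs_cases ((ψ.sem α p : ℝ) - ψ.sem α q) with ⟨he, -⟩ | ⟨he, -⟩
    -- When `ψ` is larger at `p`, its complement `1 - ψ` has the required orientation.
    · refine ⟨.homSymm 1 ψ, ?_⟩
      rw [Formula.coe_sem_homSymm, Formula.coe_sem_homSymm, Set.Icc.coe_one,
        abs_of_nonneg (sub_nonneg.2 (ψ.sem α p).2.2), abs_of_nonneg (sub_nonneg.2 (ψ.sem α q).2.2)]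
      linarith
    · exact ⟨ψ, by linarith⟩
  have hst' : (s : ℝ) ≤ t := hst
  let r : unitInterval := ⟨(t : ℝ) - s, sub_nonneg.2 hst', by linarith [t.2.2, s.2.1]⟩
  -- Shift `ψ` to vanish at `p`, cap it at `t - s`, and add `s`: the value is exactly `s` at `p` and
  -- lies in `[t - ε, t]` at `q`, so the tensor does not truncate.
  refine ⟨.tensor s ((ψ.tsub (ψ.sem α p)).or (.const r)), ?_⟩
  have ht := t.2.2
  have hs := s.2.2
  rw [Formula.coe_sem_tensor, Formula.coe_sem_tensor, Formula.coe_sem_or, Formula.coe_sem_or,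
    Formula.coe_sem_tsub, Formula.coe_sem_tsub, Formula.coe_sem_const, Formula.coe_sem_const,
    show (r : ℝ) = t - s from rfl]
  constructor
  · rw [sub_self, max_self, min_eq_left (sub_nonneg.2 hst'), add_zero, min_eq_left hs, sub_self,
      abs_zero]
    exact hε.le
  · set m := min (max ((ψ.sem α q : ℝ) - ψ.sem α p) 0) ((t : ℝ) - s) with hm
    have h1 : m ≤ t - s := min_le_right _ _
    have h2 : (t : ℝ) - s - ε ≤ m := le_min (hψ.trans (le_max_left _ _)) (by linarith)
    rw [min_eq_left (by linarith), abs_le]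
    constructor <;> linarith

theorem exists_formula_approx_pair {f : α.V → unitInterval}
    (hf : ∀ x y, |(f x : ℝ) - f y| ≤ logicalDist L α x y) (p q : α.V) {ε : ℝ} (hε : 0 < ε) :
    ∃ φ : Formula L, |(φ.sem α p : ℝ) - f p| ≤ ε ∧ |(φ.sem α q : ℝ) - f q| ≤ ε := by
  rcases le_total (f p) (f q) with h | h
  · exact exists_formula_approx_pair_of_le α h
      ((le_abs_self _).trans ((abs_sub_comm _ _).trans_le (hf p q))) hε
  · obtain ⟨φ, h1, h2⟩ := exists_formula_approx_pair_of_le α h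
      ((le_abs_self _).trans ((abs_sub_comm _ _).trans_le (hf q p))) hε
    exact ⟨φ, h2, h1⟩

/-- A lattice Stone–Weierstrass argument: formulas interpolate approximately on finite sets. -/
theorem exists_formula_approx_finset {f : α.V → unitInterval}
    (hf : ∀ x y, |(f x : ℝ) - f y| ≤ logicalDist L α x y) (S : Finset α.V) {ε : ℝ} (hε : 0 < ε) :
    ∃ φ : Formula L, ∀ p ∈ S, |(φ.sem α p : ℝ) - f p| ≤ ε := by
  classical
  -- For fixed `p`, the minimum of the pair interpolants for `(p, q)` over `q ∈ T`.
  have hinf : ∀ (p : α.V) (T : Finset α.V), ∃ φ : Formula L,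
      (f p : ℝ) - ε ≤ φ.sem α p ∧ ∀ q ∈ T, (φ.sem α q : ℝ) ≤ f q + ε := by
    intro p T
    induction T using Finset.induction_on with
    | empty =>
      refine ⟨.const 1, ?_, by simp⟩
      rw [Formula.coe_sem_const, Set.Icc.coe_one]
      linarith [(f p).2.2]
    | insert q T _ ih =>
      obtain ⟨φ, h1, h2⟩ := ih
      obtain ⟨ψ, h3, h4⟩ := exists_formula_approx_pair α hf p q hε
      rw [abs_le] at h3 h4
      refine ⟨φ.or ψ, le_min h1 (by linarith), fun q' hq' => ?_⟩
      rw [Formula.coe_sem_or]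
      rcases Finset.mem_insert.1 hq' with rfl | hq'
      · exact (min_le_right _ _).trans (by linarith)
      · exact (min_le_left _ _).trans (h2 q' hq')
  -- The maximum over `p ∈ T` of the minima built on `S`; the upper bound on `S` survives, and lower
  -- bounds accumulate.
  have hsup : ∀ T : Finset α.V, ∃ φ : Formula L,
      (∀ p ∈ T, (f p : ℝ) - ε ≤ φ.sem α p) ∧ ∀ q ∈ S, (φ.sem α q : ℝ) ≤ f q + ε := by
    intro T
    induction T using Finset.induction_on with
    | empty =>
      refine ⟨.top, by simp, fun q _ => ?_⟩
      rw [Formula.coe_sem_top]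
      linarith [(f q).2.1]
    | insert p T _ ih =>
      obtain ⟨φ, h1, h2⟩ := ih
      obtain ⟨ψ, h3, h4⟩ := hinf p S
      refine ⟨φ.and ψ, fun p' hp' => ?_, fun q hq => max_le (h2 q hq) (h4 q hq)⟩
      rw [Formula.coe_sem_and]
      rcases Finset.mem_insert.1 hp' with rfl | hp'
      · exact h3.trans (le_max_right _ _)
      · exact (h1 p' hp').trans (le_max_left _ _)
  obtain ⟨φ, h1, h2⟩ := hsup S
  exact ⟨φ, fun p hp => abs_le.2 ⟨by linarith [h1 p hp], by linarith [h2 p hp]⟩⟩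

/-- On totally bounded sets, formulas are uniformly dense among the predicates that are
non-expansive for the logical distance. -/
theorem exists_formula_approx_totallyBounded {f : α.V → unitInterval}
    (hf : ∀ x y, |(f x : ℝ) - f y| ≤ logicalDist L α x y) {Y : Set α.V} (hY : TotallyBounded Y)
    {ε : ℝ} (hε : 0 < ε) :
    ∃ φ : Formula L, ∀ p ∈ Y, |(φ.sem α p : ℝ) - f p| ≤ ε := by
  -- The net is for the original distance, which dominates the logical one. Moving `φ`, moving `f`
  -- and interpolating on the net each cost `ε / 3`.
  obtain ⟨t, ht, hYt⟩ := Metric.totallyBounded_iff.1 hY (ε / 3) (by positivity)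
  obtain ⟨φ, hφ⟩ := exists_formula_approx_finset α hf ht.toFinset (ε := ε / 3) (by positivity)
  refine ⟨φ, fun p hp => ?_⟩
  obtain ⟨q, hq, hpq⟩ := Set.mem_iUnion₂.1 (hYt hp)
  have hld := logicalDist_le_dist L α p q
  have h1 := abs_sem_sub_sem_le_logicalDist α φ p q
  have h2 := hφ q (ht.mem_toFinset.2 hq)
  have h3 := hf p q
  have h4 : dist p q < ε / 3 := hpq
  rw [abs_le] at *
  constructor <;> linarith

end Interpolation

/-! ### Expectations under tight measures and on `1 + X` -/

namespace TightProb

variable {X : BPMet.{u}}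

/-- Predicates that are uniformly close off a set of small measure have close expectations. -/
theorem abs_integral_sub_integral_le (μ : TightProb X) (f g : Pred X) {S : Set X} {ε : ℝ}
    (hε : 0 ≤ ε) (hfg : ∀ x ∈ S, |(f x : ℝ) - g x| ≤ ε)
    (hS : μ.toMeasure Sᶜ ≤ ENNReal.ofReal ε) :
    |∫ x, (f x : ℝ) ∂μ.toMeasure - ∫ x, (g x : ℝ) ∂μ.toMeasure| ≤ 2 * ε := by
  -- `S` need not be measurable, so `Sᶜ` is replaced by a measurable hull of the same measure; the
  -- difference is then dominated by `ε` plus the indicator of `T`.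
  set T := toMeasurable μ.toMeasure Sᶜ
  have hT : MeasurableSet T := measurableSet_toMeasurable _ _
  have hTε : μ.toMeasure.real T ≤ ε := by
    rw [Measure.real, measure_toMeasurable]
    exact ENNReal.toReal_le_of_le_ofReal hε hS
  have hint : Integrable (fun x => ε + T.indicator (fun _ => (1 : ℝ)) x) μ.toMeasure :=
    (integrable_const _).add ((integrable_const _).indicator hT)
  rw [← integral_sub (μ.integrable f) (μ.integrable g)]
  refine (abs_integral_le_integral_abs).trans ?_
  refine (integral_mono ((μ.integrable f).sub (μ.integrable g)).abs hint fun x => ?_).trans ?_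
  · by_cases hx : x ∈ T
    · have h1 := (f x).2
      have h2 := (g x).2
      simp only [Pi.sub_apply, Set.indicator_of_mem hx]
      rw [abs_le]
      constructor <;> linarith [h1.1, h1.2, h2.1, h2.2]
    · have hxS : x ∈ S := by
        by_contra h
        exact hx (subset_toMeasurable _ _ h)
      simpa [Set.indicator_of_notMem hx] using hfg x hxS
  · rw [integral_add (integrable_const _) ((integrable_const _).indicator hT),
      integral_indicator_const _ hT]
    simp only [integral_const, probReal_univ, smul_eq_mul, one_mul, mul_one]
    linarith

end TightProb

/-- The inclusion into `1 + X` is isometric. -/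
theorem totallyBounded_preimage_inc {X : BPMet.{u}} {Y : Set (OnePlus X)}
    (hY : TotallyBounded Y) : TotallyBounded (OnePlus.inc ⁻¹' Y : Set X) := by
  refine totallyBounded_preimage (f := (OnePlus.inc : X → OnePlus X))
    (Metric.isUniformInducing_iff.2 ?_) hY
  refine ⟨Metric.uniformContinuous_iff.2 fun ε hε => ⟨ε, hε, fun _ _ h => h⟩,
    fun ε hε => ⟨ε, hε, fun h => h⟩⟩

/-- Up to complementation, every predicate on `1 + X` is a convex combination of predicates of the
form `f^{+1}`. -/
theorem integral_onePlus_eq {X : BPMet.{u}} (μ : TightProb (onePlusFunctor.obj X))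
    (f : Pred (onePlusFunctor.obj X)) (g : Pred X) (hg : ∀ x, f (OnePlus.inc x) = g x) :
    ∫ p, (f p : ℝ) ∂μ.toMeasure =
      (f OnePlus.star : ℝ) * ∫ p, (plusOne g p : ℝ) ∂μ.toMeasure +
      (1 - (f OnePlus.star : ℝ)) *
        (1 - ∫ p, (plusOne (TightProb.compl g) p : ℝ) ∂μ.toMeasure) := by
  -- The identity holds pointwise: at the extra point only the first summand survives, and at `inc
  -- x` both weighted predicates equal `g x`.
  rw [← TightProb.integral_compl, ← integral_const_mul, ← integral_const_mul,
    ← integral_add ((μ.integrable _).const_mul _) ((μ.integrable _).const_mul _)]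
  refine integral_congr_ae (Filter.Eventually.of_forall fun p => ?_)
  beta_reduce
  rw [TightProb.coe_compl]
  rcases p with _ | x
  · change (f OnePlus.star : ℝ) = f OnePlus.star * ((1 : unitInterval) : ℝ) +
      (1 - f OnePlus.star) * (1 - ((1 : unitInterval) : ℝ))
    simp
  · change (f (OnePlus.inc x) : ℝ) = f OnePlus.star * (g x : ℝ) +
      (1 - f OnePlus.star) * (1 - (TightProb.compl g x : ℝ))
    rw [TightProb.coe_compl, hg]
    ring

/-! ### The coalgebra on the logical space -/

section ProbabilisticTransitionSystems

variable {A : Type u} [Fintype A] (α : Endofunctor.Coalgebra (ptsFunctor A))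

/-- The transition distributions of a state of a coalgebra. -/
def transition (x : α.V) (a : A) : TightProb (onePlusFunctor.obj α.V) :=
  (show A → TightProb (onePlusFunctor.obj α.V) from
    (show NonexpMap α.V ((ptsFunctor A).obj α.V) from α.str) x) a

theorem coe_sem_modal (a : A) (φ : Formula (expectationModalities A)) (x : α.V) :
    (((Formula.modal ⟨expectationAt a, a, rfl⟩ φ :
      Formula (expectationModalities A)).sem α x : unitInterval) : ℝ) =
      ∫ p, (plusOne (φ.sem α) p : ℝ) ∂(transition α x a).toMeasure := rfl

/-- Expectations of predicates that are non-expansive for the logical distance are themselves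
non-expansive for the logical distance. -/
theorem abs_integral_plusOne_sub_le_logicalDist (g : Pred α.V)
    (hg : ∀ x y, |(g x : ℝ) - g y| ≤ logicalDist (expectationModalities A) α x y)
    (a : A) (x y : α.V) :
    |∫ p, (plusOne g p : ℝ) ∂(transition α x a).toMeasure -
      ∫ p, (plusOne g p : ℝ) ∂(transition α y a).toMeasure| ≤
      logicalDist (expectationModalities A) α x y := by
  refine le_of_forall_pos_le_add fun ε hε => ?_
  -- Replacing `g` by a formula costs `2 * (ε / 4)` for each of the two measures.
  have hε4 : 0 < ε / 4 := by positivity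
  obtain ⟨Y, hY, hYx⟩ := (transition α x a).isTight _ (ENNReal.ofReal_pos.2 hε4)
  obtain ⟨Z, hZ, hZy⟩ := (transition α y a).isTight _ (ENNReal.ofReal_pos.2 hε4)
  -- One formula must serve both measures, hence the union; at the extra point both extensions equal
  -- `1`, so only the preimage in `X` matters.
  obtain ⟨φ, hφ⟩ := exists_formula_approx_totallyBounded α hg
    (totallyBounded_preimage_inc (hY.union hZ)) hε4
  have hφ' : ∀ p ∈ Y ∪ Z, |(plusOne (φ.sem α) p : ℝ) - plusOne g p| ≤ ε / 4 := by
    rintro (_ | z) hp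
    · change |((1 : unitInterval) : ℝ) - ((1 : unitInterval) : ℝ)| ≤ _
      simpa using hε4.le
    · exact hφ z hp
  have h1 := (transition α x a).abs_integral_sub_integral_le _ _ hε4.le
    (fun p hp => hφ' p (Or.inl hp)) hYx.le
  have h2 := (transition α y a).abs_integral_sub_integral_le _ _ hε4.le
    (fun p hp => hφ' p (Or.inr hp)) hZy.le
  have h3 := abs_sem_sub_sem_le_logicalDist α
    (Formula.modal ⟨expectationAt a, a, rfl⟩ φ : Formula (expectationModalities A)) x y
  rw [coe_sem_modal, coe_sem_modal] at h3
  rw [abs_le] at *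
  constructor <;> linarith

/-- The transition structure is non-expansive for the logical distance. -/
theorem dist_map_str_le_logicalDist (x y : α.V) :
    dist ((ptsFunctor A).map (toLogicalSpace (expectationModalities A) α) (α.str x))
      ((ptsFunctor A).map (toLogicalSpace (expectationModalities A) α) (α.str y)) ≤
      logicalDist (expectationModalities A) α x y := by
  have h0 : 0 ≤ logicalDist (expectationModalities A) α x y :=
    (abs_nonneg _).trans (abs_sem_sub_sem_le_logicalDist α .top x y)
  refine (dist_pi_le_iff h0).2 fun a => ?_
  change TightProb.kantDist
    (TightProb.map (onePlusFunctor.map (toLogicalSpace (expectationModalities A) α))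
      (transition α x a))
    (TightProb.map (onePlusFunctor.map (toLogicalSpace (expectationModalities A) α))
      (transition α y a)) ≤ _
  refine ciSup_le fun f => ?_
  rw [TightProb.integral_map, TightProb.integral_map]
  -- The test predicate is pulled back to the original metric, where the transition measures live;
  -- `hg` retains its stronger non-expansiveness.
  let f' : Pred (onePlusFunctor.obj α.V) :=
    NonexpMap.comp f (onePlusFunctor.map (toLogicalSpace (expectationModalities A) α))
  let g : Pred α.V := ⟨fun z => f' (OnePlus.inc z), fun z w => f'.dist_le _ _⟩
  have hg : ∀ z w, |(g z : ℝ) - g w| ≤ logicalDist (expectationModalities A) α z w :=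
    fun z w => f.dist_le (OnePlus.inc z) (OnePlus.inc w)
  have hgc : ∀ z w, |(TightProb.compl g z : ℝ) - TightProb.compl g w| ≤
      logicalDist (expectationModalities A) α z w := by
    intro z w
    rw [TightProb.coe_compl, TightProb.coe_compl, sub_sub_sub_cancel_left, abs_sub_comm]
    exact hg z w
  have h1 := abs_integral_plusOne_sub_le_logicalDist α g hg a x y
  have h2 := abs_integral_plusOne_sub_le_logicalDist α _ hgc a x y
  change ∫ p, (f' p : ℝ) ∂(transition α x a).toMeasure -
    ∫ p, (f' p : ℝ) ∂(transition α y a).toMeasure ≤ _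
  rw [integral_onePlus_eq _ f' g fun _ => rfl, integral_onePlus_eq _ f' g fun _ => rfl]
  have hc := (f' OnePlus.star).2
  -- The weights `c` and `1 - c` sum to `1`, so the two bounds add up to the logical distance. The
  -- complement reverses signs, so the second uses the lower half of `h2`.
  have h3 := mul_le_mul_of_nonneg_left (abs_le.1 h1).2 hc.1
  have h4 := mul_le_mul_of_nonneg_left (abs_le.1 h2).1 (sub_nonneg.2 hc.2)
  linarith

/-- The coalgebra structure on the state space with the logical distance. -/
def logicalCoalgebra : Endofunctor.Coalgebra (ptsFunctor A) where
  V := logicalSpace (expectationModalities A) α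
  str := (⟨fun x => (ptsFunctor A).map (toLogicalSpace (expectationModalities A) α) (α.str x),
      dist_map_str_le_logicalDist α⟩ :
    NonexpMap (logicalSpace (expectationModalities A) α)
      ((ptsFunctor A).obj (logicalSpace (expectationModalities A) α)))

/-- The identity is a coalgebra morphism to the coalgebra with the logical distance. -/
def toLogicalCoalgebra : α ⟶ logicalCoalgebra α where
  f := toLogicalSpace (expectationModalities A) α
  -- The target structure is `α.str` followed by the functor applied to this same map, so the square
  -- commutes by definition.
  h := rfl

end ProbabilisticTransitionSystems

end

theorem mainTheorem3 (A : Type u) [Fintype A] : IsExpressive (expectationModalities A) := by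
  intro α x y
  -- The distance in `logicalCoalgebra α` is `logicalDist` by definition.
  exact ciInf_le ⟨0, by rintro _ ⟨m, rfl⟩; exact dist_nonneg⟩
    (⟨logicalCoalgebra α, toLogicalCoalgebra α⟩ :
      (β : Endofunctor.Coalgebra (ptsFunctor A)) × (α ⟶ β))
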